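/- Let $d\ge 0$, $A\in\mathbb{Z}^{d\times d}$, $a,b\in\mathbb{Z}^d$, $c\in\mathbb{Z}$, and consider the loop "while $g(x)>0$ do $x:=f(x)$" with $f(x)=Ax+a$ and $g(x)=b^\top x+c$ for $x\in\mathbb{R}^d$. Call $x\in\mathbb{R}^d$ *eventually non-terminating* if there is $N$ such that $g(f^n(x))>0$ for all $n\ge N$. Let $B=\begin{pmatrix}A&a\\0&1\end{pmatrix}$ and assume that $f$ is non-degenerate: no quotient of two distinct eigenvalues of $B$ is a root of unity. Let $\lambda_1,\dots,\lambda_s$ be the distinct non-zero eigenvalues of $B$, let $k_{\max}$ be the maximum of their algebraic multiplicities, let $I=\{0,\dots,k_{\max}-1\}\times\{1,\dots,s\}$, and let $h_{i,j}:\mathbb{R}^d\to\mathbb{C}$, $(i,j)\in I$, be the affine functions with $$g(f^n(x))=\sum_{(i,j)\in I}\binom{n}{i}\lambda_j^n\,h_{i,j}(x)\qquad\text{for all }x\in\mathbb{R}^d,\ n\ge d;$$ explicitly, $h_{i,j}(x)=\lambda_j^{-i}\,(b^\top\ c)\,D_jN^i\begin{pmatrix}x\\1\end{pmatrix}$, where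 $D_j$ is the projection onto the generalized eigenspace of $B$ for $\lambda_j$ along the sum of the other generalized eigenspaces, and $N=B-\sum_j\lambda_jD_j$. Preorder $I$ by $(i_1,j_1)\preccurlyeq(i_2,j_2)$ iff $|\lambda_{j_1}|<|\lambda_{j_2}|$, or $|\lambda_{j_1}|=|\lambda_{j_2}|$ and $i_1\le i_2$, and let $\approx$ be the induced equivalence relation. An $\approx$-class $E$ is *dominant* for $x$ if it is the class of the $\preccurlyeq$-maximal indices $(i,j)$ with $h_{i,j}(x)\ne 0$. Let $\mathbb{T}=\{w\in\mathbb{C}:|w|=1\}$, $\gamma_j=\lambda_j/|\lambda_j|$, and $$T(\gamma)=\Big\{\mu\in\mathbb{T}^s:\ \mu_1^{v_1}\cdots\mu_s^{v_s}=1\ \text{for all}\ v\in\mathbb{Z}^s\ \text{with}\ \gamma_1^{v_1}\cdots\gamma_s^{v_s}=1\Big\}.$$ For an $\approx$-class $E$ put $\Phi_E(x,\mu)=\sum_{(i,j)\in E}h_{i,j}(x)\mu_j$, which is real for $x\in\mathbb{R}^d$ and $\mu\in T(\gamma)$. A point $z\in\mathbb{R}^d$ is *critical* if it has a dominant class $E$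 and $\inf_{\mu\in T(\gamma)}\Phi_E(z,\mu)=0$. **Lemma.** If $z\in\mathbb{R}^d$ is critical, then there exists a positive integer $M$ such that for all $n\ge M$, every point of the relative interior of $\mathrm{conv}(\{f^d(z),f^{d+1}(z),\dots,f^n(z)\})$ is eventually non-terminating. -/

import Mathlib

/-- The group `L(γ)` of multiplicative relations of `γ`: all integer vectors `v` with `∏ j, γ j ^ v j = 1`. -/
def multRelations {ι : Type*} [Fintype ι] (γ : ι → Circle) : Set (ι → ℤ) :=
  {v | ∏ j, γ j ^ v j = 1}

/-- `T(γ)`: the points of the torus that satisfy all multiplicative relations of `γ`. -/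
def relationTorus {ι : Type*} [Fintype ι] (γ : ι → Circle) : Set (ι → Circle) :=
  {μ | ∀ v ∈ multRelations γ, ∏ j, μ j ^ v j = 1}

/-- For an endomorphism `φ` of a finite-dimensional complex space, the projection onto the
generalized eigenspace `⋃ₙ ker (φ - r)ⁿ` along the complementary invariant subspace
`⋂ₙ range (φ - r)ⁿ` (which is the sum of the other generalized eigenspaces). -/
noncomputable def spectralProjection {V : Type*} [AddCommGroup V] [Module ℂ V]
    [FiniteDimensional ℂ V] (φ : Module.End ℂ V) (r : ℂ) : Module.End ℂ V :=
  Submodule.projection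
    (⨆ n : ℕ, LinearMap.ker ((φ - algebraMap ℂ (Module.End ℂ V) r) ^ n))
    (⨅ n : ℕ, LinearMap.range ((φ - algebraMap ℂ (Module.End ℂ V) r) ^ n))
    (LinearMap.isCompl_iSup_ker_pow_iInf_range_pow _)

/-- The data of a single-guard loop `while g(x) > 0 do x := f(x)` with
`f(x) = A x + a` and `g(x) = bᵀ x + c`, all coefficients being integers. -/
structure AffineLoop (d : ℕ) where
  A : Matrix (Fin d) (Fin d) ℤ
  a : Fin d → ℤ
  b : Fin d → ℤ
  c : ℤ

namespace AffineLoop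

/-- The update function `f(x) = A x + a` on `ℝ^d`. -/
def f {d : ℕ} (P : AffineLoop d) (x : Fin d → ℝ) : Fin d → ℝ :=
  (P.A.map (Int.cast : ℤ → ℝ)).mulVec x + fun i => (P.a i : ℝ)

/-- The guard function `g(x) = bᵀ x + c` on `ℝ^d`. -/
def g {d : ℕ} (P : AffineLoop d) (x : Fin d → ℝ) : ℝ :=
  (fun i => (P.b i : ℝ)) ⬝ᵥ x + (P.c : ℝ)

/-- `x` is eventually non-terminating: the sequence `g(fⁿ(x))` is ultimately positive. -/
def EventuallyNonTerminating {d : ℕ} (P : AffineLoop d) (x : Fin d → ℝ) : Prop :=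
  ∃ N : ℕ, ∀ n ≥ N, 0 < P.g (P.f^[n] x)

/-- The update matrix `[A a; 0 1]`, over the complex numbers. -/
def updateMatrix {d : ℕ} (P : AffineLoop d) : Matrix (Fin d ⊕ Unit) (Fin d ⊕ Unit) ℂ :=
  (Matrix.fromBlocks P.A (Matrix.of fun i _ => P.a i) 0 1).map (Int.cast : ℤ → ℂ)

/-- The update matrix as a linear endomorphism of `ℂ^(d+1)`. -/
noncomputable def updateMap {d : ℕ} (P : AffineLoop d) : Module.End ℂ (Fin d ⊕ Unit → ℂ) :=
  Matrix.toLin' P.updateMatrix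

/-- No quotient of two distinct eigenvalues of the update matrix is a root of unity.
(If one of the two eigenvalues is zero, the Lean quotient is `0`, so that the condition on this
pair holds automatically.) -/
def NonDegenerate {d : ℕ} (P : AffineLoop d) : Prop :=
  ∀ r₁ ∈ spectrum ℂ P.updateMatrix, ∀ r₂ ∈ spectrum ℂ P.updateMatrix, r₁ ≠ r₂ →
    ∀ k : ℕ, 0 < k → (r₁ / r₂) ^ k ≠ 1

/-- The finite set `{λ₁, …, λₛ}` of the distinct non-zero eigenvalues of the update matrix. -/
noncomputable def nonzeroEigenvalues {d : ℕ} (P : AffineLoop d) : Finset ℂ :=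
  P.updateMatrix.charpoly.roots.toFinset.erase 0

/-- The maximum (algebraic) multiplicity of the non-zero eigenvalues. -/
noncomputable def kMax {d : ℕ} (P : AffineLoop d) : ℕ :=
  P.nonzeroEigenvalues.sup fun r => P.updateMatrix.charpoly.rootMultiplicity r

/-- The index set `I = {0, …, kMax - 1} × {1, …, s}`; an index `j ∈ {1, …, s}` is represented
by the eigenvalue `λⱼ` itself. -/
abbrev Idx {d : ℕ} (P : AffineLoop d) : Type := Fin P.kMax × P.nonzeroEigenvalues

/-- The preorder `(i₁, j₁) ≼ (i₂, j₂)`: either `|λ_{j₁}| < |λ_{j₂}|`, or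
`|λ_{j₁}| = |λ_{j₂}|` and `i₁ ≤ i₂`. -/
def PrecEq {d : ℕ} (P : AffineLoop d) (p q : P.Idx) : Prop :=
  ‖(p.2 : ℂ)‖ < ‖(q.2 : ℂ)‖ ∨ (‖(p.2 : ℂ)‖ = ‖(q.2 : ℂ)‖ ∧ p.1 ≤ q.1)

/-- The equivalence relation `≈` induced by the preorder. -/
def Approx {d : ℕ} (P : AffineLoop d) (p q : P.Idx) : Prop :=
  P.PrecEq p q ∧ P.PrecEq q p

/-- The diagonalizable part `∑ⱼ λⱼ Dⱼ` of the update matrix in its Jordan–Chevalley decomposition,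
`Dⱼ` being the spectral projection for `λⱼ` (the eigenvalue zero contributes nothing). -/
noncomputable def semisimplePart {d : ℕ} (P : AffineLoop d) :
    Module.End ℂ (Fin d ⊕ Unit → ℂ) :=
  ∑ r ∈ P.nonzeroEigenvalues, r • spectralProjection P.updateMap r

/-- The nilpotent part `N` of the update matrix in its Jordan–Chevalley decomposition. -/
noncomputable def nilpotentPart {d : ℕ} (P : AffineLoop d) :
    Module.End ℂ (Fin d ⊕ Unit → ℂ) :=
  P.updateMap - P.semisimplePart

/-- The vector `(x, 1)` in `ℂ^(d+1)`. -/
def homogenize {d : ℕ} (x : Fin d → ℝ) : Fin d ⊕ Unit → ℂ :=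
  Sum.elim (fun i => (x i : ℂ)) fun _ => 1

/-- The row vector `(bᵀ c)`. -/
def guardVector {d : ℕ} (P : AffineLoop d) : Fin d ⊕ Unit → ℂ :=
  Sum.elim (fun i => (P.b i : ℂ)) fun _ => (P.c : ℂ)

/-- The affine functions `h_{i,j}(x) = λⱼ^(-i) (bᵀ c) Dⱼ Nⁱ (x, 1)`, the coefficients in
`g(fⁿ(x)) = ∑_{(i,j) ∈ I} binom(n,i) λⱼⁿ h_{i,j}(x)` for `n ≥ d`. -/
noncomputable def h {d : ℕ} (P : AffineLoop d) (p : P.Idx) (x : Fin d → ℝ) : ℂ :=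
  ((p.2 : ℂ) ^ (p.1 : ℕ))⁻¹ *
    (P.guardVector ⬝ᵥ
      spectralProjection P.updateMap (p.2 : ℂ) ((P.nilpotentPart ^ (p.1 : ℕ)) (homogenize x)))

/-- The normalised eigenvalues `γⱼ = λⱼ / |λⱼ|`, as points of the unit circle. -/
noncomputable def γ {d : ℕ} (P : AffineLoop d) (j : P.nonzeroEigenvalues) : Circle :=
  ⟨(j : ℂ) / (‖(j : ℂ)‖ : ℂ), by
    have hj : (j : ℂ) ≠ 0 := (Finset.mem_erase.mp j.2).1
    rw [Submonoid.unitSphere, ← SetLike.mem_coe]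
    change _ ∈ Metric.sphere (0 : ℂ) 1
    rw [mem_sphere_zero_iff_norm, norm_div, Complex.norm_real, norm_norm]
    exact div_self (norm_ne_zero_iff.mpr hj)⟩

/-- `Φ_E(x, μ) = ∑_{(i,j) ∈ E} h_{i,j}(x) μⱼ`. The sum is a real number for every `≈`-class `E`
and every `μ ∈ T(γ)`, since conjugate eigenvalues contribute conjugate summands; taking the real
part only turns it into an element of `ℝ`. -/
noncomputable def Φ {d : ℕ} (P : AffineLoop d) (E : Set P.Idx) (x : Fin d → ℝ)
    (μ : P.nonzeroEigenvalues → Circle) : ℝ :=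
  (∑ p : P.Idx, E.indicator (fun p => P.h p x * (μ p.2 : ℂ)) p).re

/-- `E` is the dominant `≈`-equivalence class for `x`: the class of the maximal indices `(i, j)`
for which `h_{i,j}(x)` is non-zero. (There is none if all `h_{i,j}(x)` vanish.) -/
def IsDominant {d : ℕ} (P : AffineLoop d) (E : Set P.Idx) (x : Fin d → ℝ) : Prop :=
  ∃ p : P.Idx, P.h p x ≠ 0 ∧ (∀ q : P.Idx, P.h q x ≠ 0 → P.PrecEq q p) ∧
    E = {q | P.Approx q p}

/-- `z` is critical: `inf_{μ ∈ T(γ)} Φ_E(z, μ) = 0` for the dominant class `E` of `z`. -/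
def IsCritical {d : ℕ} (P : AffineLoop d) (z : Fin d → ℝ) : Prop :=
  ∃ E : Set P.Idx, P.IsDominant E z ∧ IsGLB (P.Φ E z '' relationTorus P.γ) 0

end AffineLoop

/-! Let `E` be the dominant class of `z`, the class of `p₀`, and let `ρ` be the common modulus of
its eigenvalues. At and above `E` in the preorder, `f` acts on the coefficients of `z` diagonally:
`h_{i,j}(f^k z) = λⱼ^k h_{i,j}(z)`, because all corrections involve indices strictly above `E`
(`h_iterate`). Hence `Φ_E(f^k z, μ) = ρ^k Φ_E(z, γ^k μ)`, which is nonnegative by criticality, since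
`γ^k μ` stays in `T(γ)`.

For fixed `μ` these values cannot vanish for `s` consecutive `k`: as functions of `k` they are
combinations of powers of distinct `λⱼ`, and a Vandermonde argument would give `h_{p₀}(z) = 0`. So
the affine function `Φ_E(·, μ)` is nonnegative on the orbit segment and positive somewhere on it,
hence positive on the relative interior of the hull.

For `x` in that relative interior, `Φ_E(x, ·)` is thus positive on the compact set `T(γ)`, so
bounded below by some `δ > 0`. The coefficients of `x` above `E` vanish by affinity, and the closed
form of `g(f^n x)` is dominated by `binom(n,i) ρ^n Φ_E(x, γ^n)`, where `i` is the first component of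
`p₀`. -/

/-! ### Spectral projections on generalized eigenspaces -/

section SpectralProjection

variable {V : Type*} [AddCommGroup V] [Module ℂ V]

theorem sub_smul_one_mem_maxGenEigenspace (φ : Module.End ℂ V) {s : ℂ} (r : ℂ) {v : V}
    (hv : v ∈ φ.maxGenEigenspace s) : (φ - r • 1) v ∈ φ.maxGenEigenspace s :=
  Module.End.mapsTo_maxGenEigenspace_of_comm
    ((Commute.refl φ).sub_right ((Commute.one_right φ).smul_right r)) s hv

theorem sub_smul_one_pow_mem_maxGenEigenspace (φ : Module.End ℂ V) {s : ℂ} (r : ℂ) (n : ℕ) {v : V}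
    (hv : v ∈ φ.maxGenEigenspace s) : ((φ - r • 1) ^ n) v ∈ φ.maxGenEigenspace s :=
  Module.End.mapsTo_maxGenEigenspace_of_comm
    (((Commute.refl φ).sub_right ((Commute.one_right φ).smul_right r)).pow_right n) s hv

theorem pow_mem_maxGenEigenspace (φ : Module.End ℂ V) {s : ℂ} (n : ℕ) {v : V}
    (hv : v ∈ φ.maxGenEigenspace s) : (φ ^ n) v ∈ φ.maxGenEigenspace s :=
  Module.End.mapsTo_maxGenEigenspace_of_comm ((Commute.refl φ).pow_right n) s hv

variable [FiniteDimensional ℂ V]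

/-- An additive predicate that holds on all generalized eigenspaces holds everywhere. -/
theorem Module.End.maxGenEigenspace_induction (φ : Module.End ℂ V) {p : V → Prop}
    (mem : ∀ s : ℂ, ∀ v ∈ φ.maxGenEigenspace s, p v)
    (add : ∀ v w, p v → p w → p (v + w)) (v : V) : p v := by
  have hv : v ∈ ⨆ s, φ.maxGenEigenspace s := by
    rw [φ.iSup_maxGenEigenspace_eq_top]
    exact Submodule.mem_top
  exact Submodule.iSup_induction _ (motive := p) hv mem (mem 0 0 (Submodule.zero_mem _)) add

/-- A power of `φ - r` preserves the generalized eigenspace for `s` and is injective there, as its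
kernel lies in the disjoint one for `r`. By finite dimension it is surjective there. -/
theorem Module.End.maxGenEigenspace_le_range_pow (φ : Module.End ℂ V) {r s : ℂ} (h : r ≠ s)
    (n : ℕ) :
    φ.maxGenEigenspace s ≤
      LinearMap.range ((φ - algebraMap ℂ (Module.End ℂ V) r) ^ n) := by
  intro v hv
  set ψ := (φ - algebraMap ℂ (Module.End ℂ V) r) ^ n with hψ
  have hc : Commute φ ψ :=
    ((Commute.refl φ).sub_right (Algebra.commutes r φ).symm).pow_right n
  have hm := Module.End.mapsTo_maxGenEigenspace_of_comm hc s
  have hinj : Function.Injective (ψ.restrict hm) := by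
    rw [← LinearMap.ker_eq_bot, LinearMap.ker_eq_bot']
    rintro ⟨w, hw⟩ hw0
    have h0 : ψ w = 0 := congrArg Subtype.val hw0
    have hr : w ∈ φ.maxGenEigenspace r :=
      (Module.End.mem_maxGenEigenspace φ r w).2 ⟨n, by rwa [hψ, Algebra.algebraMap_eq_smul_one] at h0⟩
    have := (Submodule.disjoint_def.1 (φ.disjoint_genEigenspace h ⊤ ⊤)) w hr hw
    exact Subtype.ext this
  obtain ⟨w, hw⟩ := (LinearMap.injective_iff_surjective.1 hinj) ⟨v, hv⟩
  exact ⟨w, congrArg Subtype.val hw⟩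

theorem spectralProjection_apply_of_mem (φ : Module.End ℂ V) {r : ℂ} {v : V}
    (hv : v ∈ φ.maxGenEigenspace r) : spectralProjection φ r v = v := by
  refine Submodule.projection_apply_of_mem_left _ ?_
  obtain ⟨k, hk⟩ := (Module.End.mem_maxGenEigenspace φ r v).1 hv
  refine Submodule.mem_iSup_of_mem k ?_
  rwa [Algebra.algebraMap_eq_smul_one, LinearMap.mem_ker]

theorem spectralProjection_apply_of_mem_of_ne (φ : Module.End ℂ V) {r s : ℂ} (h : r ≠ s) {v : V}
    (hv : v ∈ φ.maxGenEigenspace s) : spectralProjection φ r v = 0 := by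
  refine (Submodule.projection_apply_eq_zero_iff _).2 ?_
  exact (Submodule.mem_iInf _).2 fun n => φ.maxGenEigenspace_le_range_pow h n hv

/-- The restriction of `φ - r` is nilpotent, so its characteristic polynomial is a power of `X` with
exponent the algebraic multiplicity; Cayley–Hamilton concludes. -/
theorem pow_rootMultiplicity_apply_eq_zero (φ : Module.End ℂ V) {r : ℂ} {k : ℕ}
    (hk : φ.charpoly.rootMultiplicity r ≤ k) {v : V} (hv : v ∈ φ.maxGenEigenspace r) :
    ((φ - r • 1) ^ k) v = 0 := by
  have hm : ∀ w ∈ φ.maxGenEigenspace r,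
      (φ - r • (1 : Module.End ℂ V)) w ∈ φ.maxGenEigenspace r :=
    fun w hw => sub_smul_one_mem_maxGenEigenspace φ r hw
  set ψ := (φ - r • (1 : Module.End ℂ V)).restrict hm with hψ
  have hchar : LinearMap.charpoly ψ = Polynomial.X ^ Module.finrank ℂ (φ.maxGenEigenspace r) := by
    refine (LinearMap.charpoly_eq_X_pow_iff ψ).2 fun w => ?_
    obtain ⟨n, hn⟩ := (Module.End.mem_maxGenEigenspace φ r w).1 w.2
    refine ⟨n, Subtype.ext ?_⟩
    rw [hψ, Module.End.pow_restrict, LinearMap.coe_restrict_apply]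
    exact hn
  have h0 : ψ ^ Module.finrank ℂ (φ.maxGenEigenspace r) = 0 := by
    have := ψ.aeval_self_charpoly
    rwa [hchar, map_pow, Polynomial.aeval_X] at this
  rw [φ.finrank_maxGenEigenspace_eq] at h0
  have h1 := congrArg Subtype.val (LinearMap.congr_fun (pow_eq_zero_of_le hk h0) ⟨v, hv⟩)
  rwa [hψ, Module.End.pow_restrict, LinearMap.coe_restrict_apply] at h1

/-- The binomial expansion of `φⁿ` on the generalized eigenspace for `r`, composed with a power of
`φ - r`. -/
theorem spectralProjection_sub_pow_apply_pow (φ : Module.End ℂ V) (r : ℂ) (i n : ℕ) (v : V) :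
    spectralProjection φ r (((φ - r • 1) ^ i) ((φ ^ n) v)) =
      ∑ l ∈ Finset.range (n + 1), ((n.choose l : ℂ) * r ^ (n - l)) •
        spectralProjection φ r (((φ - r • 1) ^ (i + l)) v) := by
  have hc : Commute (φ - r • 1) (r • (1 : Module.End ℂ V)) :=
    (Commute.one_right _).smul_right r
  have h : φ ^ n = ∑ l ∈ Finset.range (n + 1),
      ((n.choose l : ℂ) * r ^ (n - l)) • (φ - r • 1) ^ l := by
    conv_lhs => rw [← sub_add_cancel φ (r • (1 : Module.End ℂ V)), hc.add_pow]
    refine Finset.sum_congr rfl fun l _ => ?_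
    rw [smul_pow, one_pow, mul_smul_comm, mul_one, ← nsmul_eq_mul', mul_smul,
      Nat.cast_smul_eq_nsmul]
  rw [h]
  simp only [LinearMap.sum_apply, LinearMap.smul_apply, map_sum, map_smul, pow_add,
    Module.End.mul_apply]

end SpectralProjection

namespace AffineLoop

/-! ### Closed form of the guard along an orbit -/

section Algebra

variable {d : ℕ} (P : AffineLoop d)

theorem charpoly_updateMap : P.updateMap.charpoly = P.updateMatrix.charpoly :=
  Matrix.charpoly_toLin' _

theorem mem_nonzeroEigenvalues {s : ℂ} (hs : s ≠ 0) {v : Fin d ⊕ Unit → ℂ} (hv : v ≠ 0)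
    (hvs : v ∈ P.updateMap.maxGenEigenspace s) : s ∈ P.nonzeroEigenvalues := by
  have hpos : 0 < P.updateMap.charpoly.rootMultiplicity s := by
    rw [← LinearMap.finrank_maxGenEigenspace_eq, Module.finrank_pos_iff_exists_ne_zero]
    exact ⟨⟨v, hvs⟩, fun h => hv (congrArg Subtype.val h)⟩
  rw [charpoly_updateMap] at hpos
  refine Finset.mem_erase.2 ⟨hs, Multiset.mem_toFinset.2 ?_⟩
  exact Multiset.count_pos.1 (by rwa [Polynomial.count_roots])

theorem ne_zero_of_mem_nonzeroEigenvalues {r : ℂ} (hr : r ∈ P.nonzeroEigenvalues) : r ≠ 0 :=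
  (Finset.mem_erase.1 hr).1

/-- The sum of the spectral projections for the non-zero eigenvalues, weighted by any function
that vanishes at zero. -/
theorem sum_smul_spectralProjection_apply (c : ℂ → ℂ) {s : ℂ} {v : Fin d ⊕ Unit → ℂ}
    (hc : s = 0 → c s • v = 0) (hv : v ∈ P.updateMap.maxGenEigenspace s) :
    ∑ r ∈ P.nonzeroEigenvalues, c r • spectralProjection P.updateMap r v = c s • v := by
  by_cases hs : s ∈ P.nonzeroEigenvalues
  · rw [Finset.sum_eq_single_of_mem s hs, spectralProjection_apply_of_mem _ hv]
    intro r _ hr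
    rw [spectralProjection_apply_of_mem_of_ne _ hr hv, smul_zero]
  · have h0 : c s • v = 0 := by
      by_cases hs0 : s = 0
      · exact hc hs0
      · by_contra hne
        exact hs (P.mem_nonzeroEigenvalues hs0 (fun h => hne (by rw [h, smul_zero])) hv)
    rw [h0]
    refine Finset.sum_eq_zero fun r hr => ?_
    have hne : r ≠ s := fun h => hs (h ▸ hr)
    rw [spectralProjection_apply_of_mem_of_ne _ hne hv, smul_zero]

theorem nilpotentPart_apply {s : ℂ} {v : Fin d ⊕ Unit → ℂ}
    (hv : v ∈ P.updateMap.maxGenEigenspace s) :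
    P.nilpotentPart v = (P.updateMap - s • 1) v := by
  have h : P.semisimplePart v = s • v := by
    rw [semisimplePart, LinearMap.sum_apply]
    exact P.sum_smul_spectralProjection_apply id (fun h => by rw [h, id, zero_smul]) hv
  rw [nilpotentPart, LinearMap.sub_apply, h]
  rfl

theorem nilpotentPart_pow_apply {s : ℂ} {v : Fin d ⊕ Unit → ℂ}
    (hv : v ∈ P.updateMap.maxGenEigenspace s) (i : ℕ) :
    (P.nilpotentPart ^ i) v = ((P.updateMap - s • 1) ^ i) v := by
  induction i with
  | zero => rfl
  | succ i ih =>
    rw [pow_succ', pow_succ', Module.End.mul_apply, Module.End.mul_apply, ih]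
    exact P.nilpotentPart_apply (sub_smul_one_pow_mem_maxGenEigenspace _ _ _ hv)

/-- On the generalized eigenspace for `r` the two operators agree; on all others both sides are
killed by the projection. -/
theorem spectralProjection_nilpotentPart_pow (r : ℂ) (i : ℕ) (v : Fin d ⊕ Unit → ℂ) :
    spectralProjection P.updateMap r ((P.nilpotentPart ^ i) v) =
      spectralProjection P.updateMap r (((P.updateMap - r • 1) ^ i) v) := by
  induction v using Module.End.maxGenEigenspace_induction P.updateMap with
  | mem s v hv =>
    rw [P.nilpotentPart_pow_apply hv]
    by_cases h : r = s
    · rw [h]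
    · rw [spectralProjection_apply_of_mem_of_ne _ h
        (sub_smul_one_pow_mem_maxGenEigenspace _ _ _ hv),
        spectralProjection_apply_of_mem_of_ne _ h
        (sub_smul_one_pow_mem_maxGenEigenspace _ _ _ hv)]
  | add v w hv hw => simp only [map_add, hv, hw]

theorem spectralProjection_sub_pow_eq_zero {r : ℂ} (hr : r ∈ P.nonzeroEigenvalues) {i : ℕ}
    (hi : P.kMax ≤ i) (v : Fin d ⊕ Unit → ℂ) :
    spectralProjection P.updateMap r (((P.updateMap - r • 1) ^ i) v) = 0 := by
  induction v using Module.End.maxGenEigenspace_induction P.updateMap with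
  | mem s v hv =>
    by_cases h : r = s
    · subst h
      rw [pow_rootMultiplicity_apply_eq_zero _ _ hv, map_zero]
      rw [charpoly_updateMap]
      exact (Finset.le_sup (f := fun r => P.updateMatrix.charpoly.rootMultiplicity r) hr).trans hi
    · exact spectralProjection_apply_of_mem_of_ne _ h
        (sub_smul_one_pow_mem_maxGenEigenspace _ _ _ hv)
  | add v w hv hw => simp only [map_add, hv, hw, add_zero]

/-- The only missing projection is the one for eigenvalue zero, and on that generalized eigenspace
the `n`-th power vanishes once `n` reaches the dimension `d + 1`. -/
theorem sum_spectralProjection_pow_apply {n : ℕ} (hn : d + 1 ≤ n) (v : Fin d ⊕ Unit → ℂ) :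
    ∑ r ∈ P.nonzeroEigenvalues, spectralProjection P.updateMap r ((P.updateMap ^ n) v) =
      (P.updateMap ^ n) v := by
  induction v using Module.End.maxGenEigenspace_induction P.updateMap with
  | mem s v hv =>
    have := P.sum_smul_spectralProjection_apply (fun _ => 1) (s := s)
      (v := (P.updateMap ^ n) v) ?_ (pow_mem_maxGenEigenspace _ n hv)
    · simpa only [one_smul] using this
    · intro hs
      rw [one_smul]
      have h := hv
      rw [Module.End.maxGenEigenspace_eq_genEigenspace_finrank, Module.End.mem_genEigenspace_nat,
        hs, zero_smul, sub_zero, LinearMap.mem_ker] at h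
      have hle : Module.finrank ℂ (Fin d ⊕ Unit → ℂ) ≤ n := by simpa using hn
      rw [← Nat.sub_add_cancel hle, pow_add, Module.End.mul_apply, h, map_zero]
  | add v w hv hw => simp only [map_add, Finset.sum_add_distrib, hv, hw]

/-- The linear form on `ℂ^(d+1)` whose value at `(x, 1)` is `h_{i,j}(x)`, for `λⱼ = r`. -/
noncomputable def coeffForm (i : ℕ) (r : ℂ) : (Fin d ⊕ Unit → ℂ) →ₗ[ℂ] ℂ :=
  (r ^ i)⁻¹ • (dotProductBilin ℂ ℂ P.guardVector ∘ₗ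
    spectralProjection P.updateMap r ∘ₗ ((P.updateMap - r • 1) ^ i))

theorem coeffForm_apply (i : ℕ) (r : ℂ) (v : Fin d ⊕ Unit → ℂ) :
    P.coeffForm i r v = (r ^ i)⁻¹ * (P.guardVector ⬝ᵥ
      spectralProjection P.updateMap r (((P.updateMap - r • 1) ^ i) v)) := rfl

theorem h_eq_coeffForm (p : P.Idx) (x : Fin d → ℝ) :
    P.h p x = P.coeffForm p.1 p.2 (homogenize x) := by
  rw [h, spectralProjection_nilpotentPart_pow, coeffForm_apply]

theorem coeffForm_eq_zero {r : ℂ} (hr : r ∈ P.nonzeroEigenvalues) {i : ℕ}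
    (hi : P.kMax ≤ i) (v : Fin d ⊕ Unit → ℂ) : P.coeffForm i r v = 0 := by
  rw [coeffForm_apply, P.spectralProjection_sub_pow_eq_zero hr hi, dotProduct_zero, mul_zero]

/-- The normalisation `r^(-i)` turns the powers `r^(n-l)` of the binomial expansion into one common
factor `r^n`. The case `i = 0` yields the closed form, general `i` the effect of `f` on the
coefficients. -/
theorem coeffForm_pow_apply {r : ℂ} (hr : r ≠ 0) (i n : ℕ) (v : Fin d ⊕ Unit → ℂ) :
    P.coeffForm i r ((P.updateMap ^ n) v) =
      r ^ n * ∑ l ∈ Finset.range (n + 1), (n.choose l : ℂ) * P.coeffForm (i + l) r v := by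
  rw [coeffForm_apply, spectralProjection_sub_pow_apply_pow, dotProduct_sum, Finset.mul_sum,
    Finset.mul_sum]
  refine Finset.sum_congr rfl fun l hl => ?_
  have hln : l ≤ n := Nat.lt_succ_iff.1 (Finset.mem_range.1 hl)
  rw [coeffForm_apply, dotProduct_smul, smul_eq_mul, pow_add r i l]
  have h : r ^ n = r ^ (n - l) * r ^ l := by rw [← pow_add, Nat.sub_add_cancel hln]
  rw [h]
  field_simp

theorem homogenize_iterate (n : ℕ) (x : Fin d → ℝ) :
    homogenize (P.f^[n] x) = (P.updateMap ^ n) (homogenize x) := by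
  induction n with
  | zero => rfl
  | succ n ih =>
    rw [Function.iterate_succ_apply', pow_succ', Module.End.mul_apply, ← ih]
    ext i
    rcases i with i | i
    · simp [homogenize, f, updateMap, updateMatrix, Matrix.mulVec, dotProduct]
    · simp [homogenize, updateMap, updateMatrix, Matrix.mulVec, dotProduct]

theorem ofReal_g (x : Fin d → ℝ) : (P.g x : ℂ) = P.guardVector ⬝ᵥ homogenize x := by
  simp [g, guardVector, homogenize, dotProduct]

/-- The closed form of the guard along an orbit. -/
theorem ofReal_g_iterate {n : ℕ} (hn : d + 1 ≤ n) (x : Fin d → ℝ) :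
    (P.g (P.f^[n] x) : ℂ) =
      ∑ p : P.Idx, (n.choose p.1 : ℂ) * (p.2 : ℂ) ^ n * P.h p x := by
  rw [ofReal_g, homogenize_iterate, ← P.sum_spectralProjection_pow_apply hn, dotProduct_sum,
    Fintype.sum_prod_type_right, ← Finset.sum_coe_sort]
  refine Finset.sum_congr rfl fun r _ => ?_
  have h := P.coeffForm_pow_apply (P.ne_zero_of_mem_nonzeroEigenvalues r.2) 0 n (homogenize x)
  rw [coeffForm_apply, pow_zero, pow_zero, inv_one, one_mul, Module.End.one_apply] at h
  -- Both ranges are compared through their maximum: beyond `n` the binomials vanish, beyond `kMax`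
  -- the coefficients do.
  rw [h, Finset.sum_subset (Finset.range_subset_range.2 (le_max_left (n + 1) P.kMax)),
    ← Finset.sum_subset (Finset.range_subset_range.2 (le_max_right (n + 1) P.kMax)),
    Finset.mul_sum, Finset.sum_range]
  · refine Finset.sum_congr rfl fun i _ => ?_
    rw [h_eq_coeffForm, zero_add]
    ring
  · intro l _ hl
    rw [zero_add, P.coeffForm_eq_zero r.2 (by simpa using hl), mul_zero]
  · intro l _ hl
    rw [Nat.choose_eq_zero_of_lt (by simpa using hl), Nat.cast_zero, zero_mul]

end Algebra

end AffineLoop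

/-! ### Affine functions on relative interiors -/

section IntrinsicInterior

/-- An affine function that is nonnegative on a set, and positive at one of its points, is
positive on the relative interior of the convex hull. -/
theorem AffineMap.pos_of_mem_intrinsicInterior_convexHull {V : Type*} [NormedAddCommGroup V]
    [NormedSpace ℝ V] {S : Set V} (F : V →ᵃ[ℝ] ℝ) (hF : ∀ y ∈ S, 0 ≤ F y) {y : V} (hy : y ∈ S)
    (hFy : 0 < F y) {x : V} (hx : x ∈ intrinsicInterior ℝ (convexHull ℝ S)) : 0 < F x := by
  have hconv : ∀ w ∈ convexHull ℝ S, 0 ≤ F w := fun w hw =>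
    convexHull_min (t := F ⁻¹' Set.Ici 0) hF ((convex_Ici (0 : ℝ)).affine_preimage F) hw
  obtain ⟨x, hxi, rfl⟩ := mem_intrinsicInterior.1 hx
  have hyS : y ∈ affineSpan ℝ (convexHull ℝ S) :=
    subset_affineSpan ℝ _ (subset_convexHull ℝ S hy)
  -- The line from `y` through `x` stays in the hull slightly beyond `x`. If `F x ≤ 0`, then `F`
  -- would be negative there.
  let l : ℝ → affineSpan ℝ (convexHull ℝ S) := fun t =>
    ⟨AffineMap.lineMap y (x : V) t, AffineMap.lineMap_mem t hyS x.2⟩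
  have hl : Continuous l := by
    refine Continuous.subtype_mk ?_ _
    exact AffineMap.lineMap_continuous
  have hl1 : l 1 = x := Subtype.ext (AffineMap.lineMap_apply_one _ _)
  have hnear : ∀ᶠ t in nhds (1 : ℝ),
      l t ∈ ((↑) ⁻¹' convexHull ℝ S : Set (affineSpan ℝ (convexHull ℝ S))) := by
    refine hl.continuousAt.eventually ?_
    rw [hl1]
    exact mem_interior_iff_mem_nhds.1 hxi
  obtain ⟨t, ht, h1t⟩ := ((hnear.filter_mono nhdsWithin_le_nhds).and
    (self_mem_nhdsWithin : Set.Ioi (1 : ℝ) ∈ nhdsWithin 1 (Set.Ioi 1))).exists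
  have h0 : 0 ≤ F (AffineMap.lineMap y (x : V) t) := hconv _ ht
  rw [AffineMap.apply_lineMap, AffineMap.lineMap_apply_module, smul_eq_mul, smul_eq_mul] at h0
  have h1t' : (1 : ℝ) < t := h1t
  by_contra hneg
  have h2 : t * F x ≤ 0 := mul_nonpos_of_nonneg_of_nonpos (by linarith) (not_lt.1 hneg)
  have h3 : (1 - t) * F y < 0 := mul_neg_of_neg_of_pos (by linarith) hFy
  linarith

end IntrinsicInterior

namespace AffineLoop

/-! ### Complex conjugation symmetry -/

section Conjugation

variable {d : ℕ} (P : AffineLoop d)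

theorem updateMap_star (v : Fin d ⊕ Unit → ℂ) : P.updateMap (star v) = star (P.updateMap v) := by
  ext i
  simp only [updateMap, Matrix.toLin'_apply, Matrix.mulVec, dotProduct, Pi.star_apply, star_sum,
    star_mul', updateMatrix, Matrix.map_apply]
  exact Finset.sum_congr rfl fun j _ => by simp

theorem sub_smul_one_pow_star (r : ℂ) (i : ℕ) (v : Fin d ⊕ Unit → ℂ) :
    ((P.updateMap - star r • 1) ^ i) (star v) = star (((P.updateMap - r • 1) ^ i) v) := by
  induction i with
  | zero => rfl
  | succ i ih =>
    rw [pow_succ', pow_succ', Module.End.mul_apply, Module.End.mul_apply, ih]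
    simp only [LinearMap.sub_apply, LinearMap.smul_apply, Module.End.one_apply, updateMap_star,
      star_sub, star_smul]

theorem star_mem_maxGenEigenspace {s : ℂ} {v : Fin d ⊕ Unit → ℂ}
    (hv : v ∈ P.updateMap.maxGenEigenspace s) :
    star v ∈ P.updateMap.maxGenEigenspace (star s) := by
  rw [Module.End.mem_maxGenEigenspace] at hv ⊢
  obtain ⟨k, hk⟩ := hv
  exact ⟨k, by rw [sub_smul_one_pow_star, hk, star_zero]⟩

theorem spectralProjection_star (r : ℂ) (v : Fin d ⊕ Unit → ℂ) :
    spectralProjection P.updateMap (star r) (star v) =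
      star (spectralProjection P.updateMap r v) := by
  induction v using Module.End.maxGenEigenspace_induction P.updateMap with
  | mem s v hv =>
    by_cases h : r = s
    · subst h
      rw [spectralProjection_apply_of_mem _ hv,
        spectralProjection_apply_of_mem _ (P.star_mem_maxGenEigenspace hv)]
    · rw [spectralProjection_apply_of_mem_of_ne _ h hv, star_zero,
        spectralProjection_apply_of_mem_of_ne _ (fun h' => h (star_injective h'))
          (P.star_mem_maxGenEigenspace hv)]
  | add v w hv hw => simp only [star_add, map_add, hv, hw]

theorem coeffForm_star (i : ℕ) (r : ℂ) (v : Fin d ⊕ Unit → ℂ) :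
    P.coeffForm i (star r) (star v) = star (P.coeffForm i r v) := by
  have hg : star P.guardVector = P.guardVector := by
    ext j
    rcases j with j | j <;> simp [guardVector]
  rw [coeffForm_apply, coeffForm_apply, sub_smul_one_pow_star, spectralProjection_star, star_mul',
    star_inv₀, star_pow]
  congr 1
  conv_lhs => rw [← hg]
  rw [dotProduct, dotProduct, star_sum]
  simp only [Pi.star_apply, star_mul']

theorem star_homogenize (x : Fin d → ℝ) : star (homogenize x) = homogenize x := by
  ext j
  rcases j with j | j <;> simp [homogenize]

theorem star_mem_nonzeroEigenvalues {r : ℂ} (hr : r ∈ P.nonzeroEigenvalues) :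
    star r ∈ P.nonzeroEigenvalues := by
  have h0 := P.ne_zero_of_mem_nonzeroEigenvalues hr
  have hroot := Polynomial.isRoot_of_mem_roots (Multiset.mem_toFinset.1 (Finset.mem_erase.1 hr).2)
  rw [← charpoly_updateMap, ← Module.End.hasEigenvalue_iff_isRoot_charpoly] at hroot
  obtain ⟨v, hv⟩ := hroot.exists_hasEigenvector
  refine P.mem_nonzeroEigenvalues (v := star v) (fun h => h0 (star_eq_zero.1 h))
    (fun h => hv.2 (star_eq_zero.1 h)) (P.star_mem_maxGenEigenspace ?_)
  exact Module.End.eigenspace_le_maxGenEigenspace hv.1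

/-- Complex conjugation of the eigenvalues. -/
noncomputable def conjEigenvalue (j : P.nonzeroEigenvalues) : P.nonzeroEigenvalues :=
  ⟨star (j : ℂ), P.star_mem_nonzeroEigenvalues j.2⟩

theorem conjEigenvalue_involutive : Function.Involutive P.conjEigenvalue := fun j =>
  Subtype.ext (star_star (j : ℂ))

theorem coe_γ (j : P.nonzeroEigenvalues) : (P.γ j : ℂ) = (j : ℂ) / (‖(j : ℂ)‖ : ℂ) := rfl

theorem norm_mul_γ (j : P.nonzeroEigenvalues) : (‖(j : ℂ)‖ : ℂ) * (P.γ j : ℂ) = j := by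
  rw [coe_γ]
  refine mul_div_cancel₀ _ ?_
  exact Complex.ofReal_ne_zero.2 (norm_ne_zero_iff.2 (P.ne_zero_of_mem_nonzeroEigenvalues j.2))

theorem γ_mul_γ_conjEigenvalue (j : P.nonzeroEigenvalues) :
    P.γ j * P.γ (P.conjEigenvalue j) = 1 := by
  have h0 : (‖(j : ℂ)‖ : ℂ) ≠ 0 :=
    Complex.ofReal_ne_zero.2 (norm_ne_zero_iff.2 (P.ne_zero_of_mem_nonzeroEigenvalues j.2))
  refine Subtype.ext ?_
  change (P.γ j : ℂ) * (P.γ (P.conjEigenvalue j) : ℂ) = 1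
  rw [coe_γ, coe_γ]
  change (j : ℂ) / (‖(j : ℂ)‖ : ℂ) * (star (j : ℂ) / (‖star (j : ℂ)‖ : ℂ)) = 1
  rw [norm_star, div_mul_div_comm, div_eq_one_iff_eq (mul_ne_zero h0 h0)]
  have := Complex.mul_conj' (j : ℂ)
  rw [sq] at this
  exact this

/-- The identity `γⱼ γ_{j̄} = 1` is a multiplicative relation of `γ`, hence is inherited by every
`μ` in the torus. -/
theorem relationTorus_conjEigenvalue {μ : P.nonzeroEigenvalues → Circle}
    (hμ : μ ∈ relationTorus P.γ) (j : P.nonzeroEigenvalues) :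
    (μ (P.conjEigenvalue j) : ℂ) = star (μ j : ℂ) := by
  classical
  -- The sum of two unit vectors also covers a real eigenvalue, where both coincide and the exponent
  -- is 2.
  have key : ∀ ν : P.nonzeroEigenvalues → Circle,
      ∏ k, ν k ^ ((Pi.single j 1 + Pi.single (P.conjEigenvalue j) 1 :
        P.nonzeroEigenvalues → ℤ) k) = ν j * ν (P.conjEigenvalue j) := by
    intro ν
    simp only [Pi.add_apply, zpow_add, Finset.prod_mul_distrib]
    congr 1
    · rw [Finset.prod_eq_single j] <;> simp +contextual
    · rw [Finset.prod_eq_single (P.conjEigenvalue j)] <;> simp +contextual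
  have h := hμ _ ((key P.γ).trans (P.γ_mul_γ_conjEigenvalue j))
  rw [key, mul_comm] at h
  rw [eq_inv_of_mul_eq_one_left h, Circle.coe_inv_eq_conj]
  rfl

end Conjugation

end AffineLoop

/-! ### The torus of multiplicative relations -/

section Torus

theorem isCompact_relationTorus {ι : Type*} [Fintype ι] (γ : ι → Circle) :
    IsCompact (relationTorus γ) := by
  refine IsClosed.isCompact ?_
  have h : relationTorus γ = ⋂ v ∈ multRelations γ, {μ | ∏ j, μ j ^ v j = 1} := by
    ext μ
    simp [relationTorus]
  rw [h]
  refine isClosed_biInter fun v _ => isClosed_eq ?_ continuous_const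
  exact continuous_finsetProd _ fun j _ => (continuous_apply j).zpow (v j)

theorem one_mem_relationTorus {ι : Type*} [Fintype ι] (γ : ι → Circle) :
    1 ∈ relationTorus γ := fun v _ => by simp

theorem pow_mul_mem_relationTorus {ι : Type*} [Fintype ι] {γ μ : ι → Circle}
    (hμ : μ ∈ relationTorus γ) (k : ℕ) : γ ^ k * μ ∈ relationTorus γ := by
  intro v hv
  have h : ∏ j, (γ ^ k * μ) j ^ v j = (∏ j, γ j ^ v j) ^ k * ∏ j, μ j ^ v j := by
    rw [← Finset.prod_pow, ← Finset.prod_mul_distrib]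
    refine Finset.prod_congr rfl fun j _ => ?_
    rw [Pi.mul_apply, Pi.pow_apply, mul_zpow, ← zpow_natCast, ← zpow_natCast, zpow_comm]
  rw [h, hv, hμ v hv, one_pow, one_mul]

end Torus

open Filter Topology

/-! ### Growth comparison of `binom(n,i) r^n` -/

section Asymptotics

theorem isLittleO_choose_of_lt {i j : ℕ} (h : i < j) :
    (fun n : ℕ => (n.choose i : ℝ)) =o[atTop] fun n : ℕ => (n.choose j : ℝ) := by
  refine (isTheta_choose i).trans_isLittleO (Asymptotics.IsLittleO.trans_isTheta ?_
    (isTheta_choose j).symm)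
  exact (Asymptotics.isLittleO_pow_pow_atTop_of_lt h).comp_tendsto tendsto_natCast_atTop_atTop

theorem isLittleO_choose_mul_pow_of_lt (i j : ℕ) {r ρ : ℝ} (hr : 0 ≤ r) (h : r < ρ) :
    (fun n : ℕ => (n.choose i : ℝ) * r ^ n) =o[atTop] fun n : ℕ => (n.choose j : ℝ) * ρ ^ n := by
  have h1 : (fun n : ℕ => (n : ℝ) ^ i * r ^ n) =o[atTop] fun n : ℕ => ρ ^ n :=
    isLittleO_pow_const_mul_const_pow_const_pow_of_norm_lt i (by rwa [Real.norm_of_nonneg hr])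
  have h2 : (fun n : ℕ => ρ ^ n) =O[atTop] fun n : ℕ => (n.choose j : ℝ) * ρ ^ n := by
    refine Asymptotics.IsBigO.of_bound 1 ?_
    filter_upwards [eventually_ge_atTop j] with n hn
    rw [one_mul, norm_mul]
    refine le_mul_of_one_le_left (norm_nonneg _) ?_
    rw [Real.norm_natCast]
    exact_mod_cast Nat.choose_pos hn
  exact (((isTheta_choose i).isBigO.mul (Asymptotics.isBigO_refl _ _)).trans_isLittleO h1).trans_isBigO h2

end Asymptotics

/-! ### Reality and affinity of `Φ_E` -/

namespace AffineLoop

variable {d : ℕ} (P : AffineLoop d)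

/-- The complex number `∑_{(i,j) ∈ E} h_{i,j}(x) μⱼ`, of which `Φ_E(x, μ)` is the real part. -/
noncomputable def classSum (E : Set P.Idx) (x : Fin d → ℝ)
    (μ : P.nonzeroEigenvalues → Circle) : ℂ :=
  ∑ p : P.Idx, E.indicator (fun p => P.h p x * (μ p.2 : ℂ)) p

theorem Φ_eq_re_classSum (E : Set P.Idx) (x : Fin d → ℝ) (μ : P.nonzeroEigenvalues → Circle) :
    P.Φ E x μ = (P.classSum E x μ).re := rfl

theorem h_conjEigenvalue (i : Fin P.kMax) (j : P.nonzeroEigenvalues) (x : Fin d → ℝ) :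
    P.h (i, P.conjEigenvalue j) x = star (P.h (i, j) x) := by
  rw [h_eq_coeffForm, h_eq_coeffForm, ← coeffForm_star, star_homogenize]
  rfl

theorem approx_iff {p q : P.Idx} :
    P.Approx q p ↔ ‖(q.2 : ℂ)‖ = ‖(p.2 : ℂ)‖ ∧ q.1 = p.1 := by
  constructor
  · rintro ⟨h1 | h1, h2 | h2⟩
    · exact absurd h1 h2.not_gt
    · exact absurd h2.1 h1.ne'
    · exact absurd h1.1 h2.ne'
    · exact ⟨h1.1, le_antisymm h1.2 h2.2⟩
  · rintro ⟨h1, h2⟩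
    exact ⟨Or.inr ⟨h1, h2.le⟩, Or.inr ⟨h1.symm, h2.ge⟩⟩

theorem precEq_of_not_precEq {p q : P.Idx} (h : ¬ P.PrecEq q p) : P.PrecEq p q := by
  simp only [PrecEq, not_or, not_lt, not_and, not_le] at h ⊢
  rcases h.1.lt_or_eq with h1 | h1
  · exact Or.inl h1
  · exact Or.inr ⟨h1, (h.2 h1.symm).le⟩

/-- Conjugating eigenvalues preserves moduli, so it permutes the class and conjugates each summand.
-/
theorem conj_classSum (p₀ : P.Idx) (x : Fin d → ℝ) {μ : P.nonzeroEigenvalues → Circle}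
    (hμ : μ ∈ relationTorus P.γ) :
    star (P.classSum {q | P.Approx q p₀} x μ) = P.classSum {q | P.Approx q p₀} x μ := by
  classical
  let e : P.Idx ≃ P.Idx := (Equiv.refl _).prodCongr P.conjEigenvalue_involutive.toPerm
  rw [classSum, star_sum, ← Equiv.sum_comp e]
  refine Finset.sum_congr rfl fun p _ => ?_
  have he : e p = (p.1, P.conjEigenvalue p.2) := rfl
  have hmem : (P.Approx (e p) p₀ ↔ P.Approx p p₀) := by
    rw [approx_iff, approx_iff, he]
    have : ‖(P.conjEigenvalue p.2 : ℂ)‖ = ‖(p.2 : ℂ)‖ := norm_star _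
    simp only [this]
  simp only [Set.indicator_apply, Set.mem_ofPred_eq, hmem]
  split_ifs
  · rw [he, h_conjEigenvalue, P.relationTorus_conjEigenvalue hμ, star_mul', star_star, star_star]
  · exact star_zero _

/-- The Vandermonde argument needs the whole complex sum to vanish, not merely its real part. -/
theorem ofReal_Φ (p₀ : P.Idx) (x : Fin d → ℝ) {μ : P.nonzeroEigenvalues → Circle}
    (hμ : μ ∈ relationTorus P.γ) :
    (P.Φ {q | P.Approx q p₀} x μ : ℂ) = P.classSum {q | P.Approx q p₀} x μ :=
  Complex.conj_eq_iff_re.1 (P.conj_classSum p₀ x hμ)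

/-- `homogenize` as an affine map. -/
noncomputable def homogenizeAffine (d : ℕ) : (Fin d → ℝ) →ᵃ[ℝ] (Fin d ⊕ Unit → ℂ) where
  toFun := homogenize
  linear :=
    { toFun := fun v => Sum.elim (fun i => (v i : ℂ)) 0
      map_add' := fun v w => by ext (i | i) <;> simp
      map_smul' := fun t v => by ext (i | i) <;> simp }
  map_vadd' := fun x v => by ext (i | i) <;> simp [homogenize]

/-- The function `h_{i,j}` as an affine map. -/
noncomputable def hAffine (p : P.Idx) : (Fin d → ℝ) →ᵃ[ℝ] ℂ :=
  ((P.coeffForm p.1 p.2).restrictScalars ℝ).toAffineMap.comp (homogenizeAffine d)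

theorem hAffine_apply (p : P.Idx) (x : Fin d → ℝ) : P.hAffine p x = P.h p x :=
  (P.h_eq_coeffForm p x).symm

open Classical in
/-- The function `Φ_E(·, μ)` as an affine map. -/
noncomputable def ΦAffine (E : Set P.Idx) (μ : P.nonzeroEigenvalues → Circle) :
    (Fin d → ℝ) →ᵃ[ℝ] ℝ :=
  (Complex.reLm ∘ₗ (∑ p : P.Idx,
    if p ∈ E then (μ p.2 : ℂ) • P.coeffForm p.1 p.2 else 0).restrictScalars ℝ).toAffineMap.comp
      (homogenizeAffine d)

theorem ΦAffine_apply (E : Set P.Idx) (μ : P.nonzeroEigenvalues → Circle) (x : Fin d → ℝ) :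
    P.ΦAffine E μ x = P.Φ E x μ := by
  classical
  change ((∑ p : P.Idx, if p ∈ E then (μ p.2 : ℂ) • P.coeffForm p.1 p.2 else 0)
    (homogenize x)).re = _
  rw [LinearMap.sum_apply, Φ]
  congr 1
  refine Finset.sum_congr rfl fun p _ => ?_
  rw [Set.indicator_apply]
  split_ifs
  · rw [h_eq_coeffForm, mul_comm]
    rfl
  · rfl

/-! ### The dominant class along the orbit -/

section Dominant

variable {P} {p₀ : P.Idx} {z : Fin d → ℝ}

/-- In `coeffForm_pow_apply` the terms with `l > 0` have index strictly above `p₀`, or beyond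
`kMax`, and so vanish at `z`. -/
theorem h_iterate (hz : ∀ q : P.Idx, P.h q z ≠ 0 → P.PrecEq q p₀)
    {q : P.Idx} (hq : P.PrecEq p₀ q) (k : ℕ) :
    P.h q (P.f^[k] z) = (q.2 : ℂ) ^ k * P.h q z := by
  rw [h_eq_coeffForm, homogenize_iterate,
    P.coeffForm_pow_apply (P.ne_zero_of_mem_nonzeroEigenvalues q.2.2), h_eq_coeffForm]
  congr 1
  rw [Finset.sum_eq_single_of_mem 0 (by simp), Nat.choose_zero_right, Nat.cast_one, one_mul,
    add_zero]
  intro l _ hl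
  by_cases hlt : (q.1 : ℕ) + l < P.kMax
  · have h0 : P.h (⟨q.1 + l, hlt⟩, q.2) z = 0 := by
      by_contra hne
      have hlt' : q.1 < (⟨q.1 + l, hlt⟩ : Fin P.kMax) := by
        rw [Fin.lt_def]
        exact Nat.lt_add_of_pos_right (Nat.pos_of_ne_zero hl)
      rcases hz _ hne with h1 | ⟨h1, h1'⟩ <;> rcases hq with h2 | ⟨h2, h2'⟩
      · exact h1.not_gt h2
      · exact h1.ne h2.symm
      · exact h2.ne h1.symm
      · exact (hlt'.trans_le (h1'.trans h2')).false
    rw [h_eq_coeffForm] at h0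
    rw [h0, mul_zero]
  · rw [P.coeffForm_eq_zero q.2.2 (not_lt.1 hlt), mul_zero]

/-- Within a class all moduli agree, so `λⱼ^k` splits into a common real factor and `γⱼ^k`. -/
theorem classSum_iterate (hz : ∀ q : P.Idx, P.h q z ≠ 0 → P.PrecEq q p₀)
    (μ : P.nonzeroEigenvalues → Circle) (k : ℕ) :
    P.classSum {q | P.Approx q p₀} (P.f^[k] z) μ =
      ((‖(p₀.2 : ℂ)‖ ^ k : ℝ) : ℂ) * P.classSum {q | P.Approx q p₀} z (P.γ ^ k * μ) := by
  classical
  rw [classSum, classSum, Finset.mul_sum]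
  refine Finset.sum_congr rfl fun p _ => ?_
  simp only [Set.indicator_apply, Set.mem_ofPred_eq]
  split_ifs with hp
  · rw [h_iterate hz hp.2, Pi.mul_apply, Pi.pow_apply, Circle.coe_mul, Circle.coe_pow,
      ← ((P.approx_iff).1 hp).1, Complex.ofReal_pow]
    conv_lhs => rw [← P.norm_mul_γ p.2]
    ring
  · rw [mul_zero]

theorem Φ_iterate (hz : ∀ q : P.Idx, P.h q z ≠ 0 → P.PrecEq q p₀)
    (μ : P.nonzeroEigenvalues → Circle) (k : ℕ) :
    P.Φ {q | P.Approx q p₀} (P.f^[k] z) μ =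
      ‖(p₀.2 : ℂ)‖ ^ k * P.Φ {q | P.Approx q p₀} z (P.γ ^ k * μ) := by
  rw [Φ_eq_re_classSum, classSum_iterate hz, Complex.re_ofReal_mul, Φ_eq_re_classSum]

/-- If `Φ_E(·, μ)` vanishes on a long enough piece of the orbit, then so do the coefficients. -/
theorem h_eq_zero_of_Φ_iterate_eq_zero (hz : ∀ q : P.Idx, P.h q z ≠ 0 → P.PrecEq q p₀)
    {μ : P.nonzeroEigenvalues → Circle}
    (hμ : μ ∈ relationTorus P.γ) {n : ℕ} (hn : d + P.nonzeroEigenvalues.card ≤ n)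
    (h0 : ∀ k ∈ Set.Icc d n, P.Φ {q | P.Approx q p₀} (P.f^[k] z) μ = 0) : P.h p₀ z = 0 := by
  classical
  let e := P.nonzeroEigenvalues.equivFin
  -- The class fixes the first index, so it has at most one term per eigenvalue. The factor `λⱼ^d`
  -- shifts the window to start at exponent zero.
  let c : P.nonzeroEigenvalues → ℂ := fun j =>
    if P.Approx (p₀.1, j) p₀ then P.h (p₀.1, j) z * (μ j : ℂ) * (j : ℂ) ^ d else 0
  -- Vandermonde at the distinct `λⱼ`, using the `s` exponents `d, …, d + s - 1`.
  have hc : (fun m => c (e.symm m)) = 0 := by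
    refine Matrix.eq_zero_of_forall_pow_sum_mul_pow_eq_zero
      (f := fun m => ((e.symm m : P.nonzeroEigenvalues) : ℂ))
      (fun a b hab => e.symm.injective (Subtype.ext hab)) fun k => ?_
    have h1 := P.ofReal_Φ p₀ (P.f^[d + k] z) hμ
    rw [h0 (d + k) ⟨Nat.le_add_right _ _, by omega⟩, Complex.ofReal_zero, classSum,
      Fintype.sum_prod_type_right] at h1
    rw [Equiv.sum_comp e.symm (fun j => c j * (j : ℂ) ^ (k : ℕ))]
    rw [h1]
    refine Finset.sum_congr rfl fun j _ => ?_
    rw [Finset.sum_eq_single_of_mem p₀.1 (Finset.mem_univ _)]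
    · simp only [c, Set.indicator_apply, Set.mem_ofPred_eq]
      split_ifs with hj
      · rw [h_iterate hz hj.2, pow_add]
        ring
      · exact zero_mul _
    · intro i _ hi
      refine Set.indicator_of_notMem (fun hi' => hi ?_) _
      exact ((P.approx_iff).1 hi').2
  have h2 := congrFun hc (e p₀.2)
  simp only [Equiv.symm_apply_apply, c, Prod.mk.eta, Pi.zero_apply] at h2
  rw [if_pos (P.approx_iff.2 ⟨rfl, rfl⟩)] at h2
  have h3 : (p₀.2 : ℂ) ^ d ≠ 0 := pow_ne_zero _ (P.ne_zero_of_mem_nonzeroEigenvalues p₀.2.2)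
  have h4 : (μ p₀.2 : ℂ) ≠ 0 := Circle.coe_ne_zero _
  exact (mul_eq_zero.1 ((mul_eq_zero.1 h2).resolve_right h3)).resolve_right h4

end Dominant

/-- A point whose coefficients vanish above the class of `p₀`, and for which `Φ` is positive on
the torus, is eventually non-terminating. -/
theorem eventuallyNonTerminating_of_Φ_pos {p₀ : P.Idx} {x : Fin d → ℝ}
    (hx : ∀ q : P.Idx, P.h q x ≠ 0 → P.PrecEq q p₀)
    (hpos : ∀ μ ∈ relationTorus P.γ, 0 < P.Φ {q | P.Approx q p₀} x μ) :
    P.EventuallyNonTerminating x := by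
  classical
  set E := {q | P.Approx q p₀} with hE
  have hcont : Continuous fun μ => P.Φ E x μ := by
    unfold Φ
    refine Complex.continuous_re.comp (continuous_finsetSum _ fun p _ => ?_)
    by_cases hp : p ∈ E
    · simp only [Set.indicator_of_mem hp]
      exact continuous_const.mul (continuous_subtype_val.comp (continuous_apply p.2))
    · simp only [Set.indicator_of_notMem hp]
      exact continuous_const
  -- Compactness turns pointwise positivity into a uniform positive lower bound.
  obtain ⟨μ₀, hμ₀, hmin⟩ := (isCompact_relationTorus P.γ).exists_isMinOn
    ⟨1, one_mem_relationTorus P.γ⟩ hcont.continuousOn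
  have hδ := hpos μ₀ hμ₀
  set ρ : ℝ := ‖(p₀.2 : ℂ)‖ with hρ
  have hρ0 : 0 < ρ := norm_pos_iff.2 (P.ne_zero_of_mem_nonzeroEigenvalues p₀.2.2)
  set D : ℕ → ℝ := fun n => (n.choose p₀.1 : ℝ) * ρ ^ n with hD
  have hsmall : (fun n : ℕ => ∑ p : P.Idx, if p ∈ E then 0 else
      (n.choose p.1 : ℂ) * (p.2 : ℂ) ^ n * P.h p x) =o[atTop] D := by
    refine Asymptotics.IsLittleO.fun_sum fun p _ => ?_
    by_cases hp : p ∈ E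
    · simp only [if_pos hp]
      exact Asymptotics.isLittleO_zero _ _
    · simp only [if_neg hp]
      by_cases h0 : P.h p x = 0
      · simp only [h0, mul_zero]
        exact Asymptotics.isLittleO_zero _ _
      · have hlt : (fun n : ℕ => (n.choose p.1 : ℝ) * ‖(p.2 : ℂ)‖ ^ n) =o[atTop] D := by
          rcases hx p h0 with h1 | ⟨h1, h1'⟩
          · exact isLittleO_choose_mul_pow_of_lt _ _ (norm_nonneg _) h1
          · rw [h1]
            have hne : p.1 ≠ p₀.1 := fun h => hp ((P.approx_iff).2 ⟨h1, h⟩)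
            exact (isLittleO_choose_of_lt (Fin.lt_def.1 (lt_of_le_of_ne h1' hne))).mul_isBigO
              (Asymptotics.isBigO_refl _ _)
        have hB : (fun n : ℕ => (n.choose p.1 : ℂ) * (p.2 : ℂ) ^ n * P.h p x) =O[atTop]
            fun n : ℕ => (n.choose p.1 : ℝ) * ‖(p.2 : ℂ)‖ ^ n := by
          refine Asymptotics.IsBigO.of_bound ‖P.h p x‖ (Eventually.of_forall fun n => ?_)
          simp only [norm_mul, norm_pow, Complex.norm_natCast, Real.norm_natCast, norm_norm]
          exact le_of_eq (mul_comm _ _)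
        exact hB.trans_isLittleO hlt
  -- An error below half the minimum leaves the main term positive.
  have hev := hsmall.bound (half_pos hδ)
  obtain ⟨N, hN⟩ := eventually_atTop.1
    ((hev.and (eventually_ge_atTop (d + 1))).and (eventually_ge_atTop (p₀.1 : ℕ)))
  refine ⟨N, fun n hn => ?_⟩
  obtain ⟨⟨hb, hnd⟩, hni⟩ := hN n hn
  have hDpos : 0 < D n := mul_pos (by exact_mod_cast Nat.choose_pos hni) (pow_pos hρ0 n)
  have hγ : P.γ ^ n * 1 ∈ relationTorus P.γ :=
    pow_mul_mem_relationTorus (one_mem_relationTorus P.γ) n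
  have hsplit : (P.g (P.f^[n] x) : ℂ) = (D n : ℂ) * P.classSum E x (P.γ ^ n * 1) +
      ∑ p : P.Idx, if p ∈ E then 0 else (n.choose p.1 : ℂ) * (p.2 : ℂ) ^ n * P.h p x := by
    rw [P.ofReal_g_iterate hnd, classSum, Finset.mul_sum, ← Finset.sum_add_distrib]
    refine Finset.sum_congr rfl fun p _ => ?_
    rw [Set.indicator_apply]
    split_ifs with hp
    · obtain ⟨h1, h2⟩ := (P.approx_iff).1 hp
      rw [Pi.mul_apply, Pi.pow_apply, Pi.one_apply, mul_one, Circle.coe_pow, add_zero]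
      conv_lhs => rw [← P.norm_mul_γ p.2]
      simp only [hD, hρ, h1, h2]
      push_cast
      ring
    · rw [mul_zero, zero_add]
  have hre := congrArg Complex.re hsplit
  rw [Complex.ofReal_re, Complex.add_re, Complex.re_ofReal_mul, ← Φ_eq_re_classSum] at hre
  have h1 : P.Φ E x μ₀ ≤ P.Φ E x (P.γ ^ n * 1) := hmin hγ
  have h2 := (abs_le.1 ((Complex.abs_re_le_norm _).trans hb)).1
  rw [Real.norm_of_nonneg hDpos.le] at h2
  have h3 := mul_le_mul_of_nonneg_left h1 hDpos.le
  have h4 : 0 < D n * P.Φ E x μ₀ := mul_pos hDpos hδ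
  rw [hre]
  linarith

end AffineLoop

/-! ### The lemma on critical points -/

theorem mainTheorem4 (d : ℕ) (P : AffineLoop d) (hP : P.NonDegenerate)
    (z : Fin d → ℝ) (hz : P.IsCritical z) :
    ∃ M : ℕ, 0 < M ∧ ∀ n ≥ M,
      ∀ x ∈ intrinsicInterior ℝ (convexHull ℝ ((fun k => P.f^[k] z) '' Set.Icc d n)),
        P.EventuallyNonTerminating x := by
  obtain ⟨E, ⟨p₀, hp₀, hmax, rfl⟩, hglb⟩ := hz
  -- The window from `d` to `n` must contain `s` consecutive exponents; the extra 1 makes `M`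
  -- visibly positive.
  refine ⟨d + P.nonzeroEigenvalues.card + 1, Nat.succ_pos _, fun n hn x hx => ?_⟩
  refine P.eventuallyNonTerminating_of_Φ_pos (p₀ := p₀) (fun q hq => ?_) fun μ hμ => ?_
  · by_contra hnot
    refine hq ?_
    -- Coefficients above the class vanish along the orbit, hence by affinity on its hull.
    have hsub : convexHull ℝ ((fun k => P.f^[k] z) '' Set.Icc d n) ⊆ P.hAffine q ⁻¹' {0} := by
      refine convexHull_min ?_ ((convex_singleton (0 : ℂ)).affine_preimage _)
      rintro _ ⟨k, -, rfl⟩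
      rw [Set.mem_preimage, AffineLoop.hAffine_apply, Set.mem_singleton_iff,
        AffineLoop.h_iterate hmax (P.precEq_of_not_precEq hnot)]
      rw [not_imp_comm.1 (hmax q) hnot, mul_zero]
    rw [← AffineLoop.hAffine_apply]
    exact hsub (intrinsicInterior_subset hx)
  · rw [← AffineLoop.ΦAffine_apply]
    have hnonneg : ∀ k, 0 ≤ P.Φ {q | P.Approx q p₀} (P.f^[k] z) μ := fun k => by
      rw [AffineLoop.Φ_iterate hmax]
      exact mul_nonneg (pow_nonneg (norm_nonneg _) _)
        (hglb.1 ⟨_, pow_mul_mem_relationTorus hμ k, rfl⟩)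
    have hex : ∃ k ∈ Set.Icc d n, 0 < P.Φ {q | P.Approx q p₀} (P.f^[k] z) μ := by
      by_contra! hall
      exact hp₀ (AffineLoop.h_eq_zero_of_Φ_iterate_eq_zero hmax hμ (n := n) (by omega)
        fun k hk => le_antisymm (hall k hk) (hnonneg k))
    obtain ⟨k, hk, hkpos⟩ := hex
    refine AffineMap.pos_of_mem_intrinsicInterior_convexHull _ ?_ (Set.mem_image_of_mem _ hk)
      (by rwa [AffineLoop.ΦAffine_apply]) hx
    rintro _ ⟨k, -, rfl⟩
    rw [AffineLoop.ΦAffine_apply]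
    exact hnonneg k
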